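/- Let $m,n\ge 1$ be integers with $\max(m,n)>1$. Let $K$ be the $m\times n$ Klein bottle obtained from the rectangle $[0,m]\times[0,n]$ by identifying $(0,y)$ with $(m,y)$ for all $y\in[0,n]$ and $(x,0)$ with $(m-x,n)$ for all $x\in[0,m]$; equivalently $K=\mathbb R^2/\!\sim$, where $(x,y)\sim((-1)^k x+jm,\;y+kn)$ for all $j,k\in\mathbb Z$. Let $p\colon\mathbb R^2\to K$ be the quotient map. Let $C$ be the cylinder obtained from the same rectangle by making only the identifications $(0,y)\sim(m,y)$, and let $q\colon C\to K$ be the standard quotient map. Let $K_{m,n}$ be the pseudograph of knight moves on $K$: its vertices are the $mn$ unit squares, i.e. the pairs $(a,b)$ of integers with $0\le a<m$ and $0\le b<n$, and it has one edge for each knight move from $(a,b)$ by a vector $(c,d)$ with $\{|c|,|d|\}=\{1,2\}$, leading to the square whose centre is $p(a+c+\tfrac12,\,b+d+\tfrac12)$; a move and the move that undoes it along the same segment are the same edge, and loops and multiple edges are allowed. A knight's tour on $K_{m,n}$ is a Hamiltonian cycle, i.e. a closed walk that visits every vertex exactly once and repeats no edge. Regarded as a loop based at $(0,0)$, it realizes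 an element of $\pi_1(K,v)$, $v=p(\tfrac12,\tfrac12)$, by sending each move $(c,d)$ from $(a,b)$ to the image under $p$ of the line segment from $(a+\tfrac12,b+\tfrac12)$ to $(a+c+\tfrac12,b+d+\tfrac12)$. The tour is cylindrical if this element is the image under $q_*$ of a generator of $\pi_1(C)\cong\mathbb Z$ (based at the point $(\tfrac12,\tfrac12)$). Then $K_{m,n}$ has a cylindrical tour if and only if none of the following is true: - $m=2$ and $n=2$; - $m$ is odd and $n$ is even. -/

import Mathlib

/-!  Closed knight's tours on the `m × n` Klein bottle board, as loops in the Klein bottle. -/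

noncomputable section

namespace KnightTour

/-- Two points of the plane are identified if they differ by a glide reflection or translation
`(x, y) ↦ ((-1) ^ k * x + j * m, y + k * n)` with `j k : ℤ`.  On the rectangle `[0, m] × [0, n]`
this glues `(0, y)` to `(m, y)` and `(x, 0)` to `(m - x, n)`. -/
def kleinSetoid (m n : ℕ) : Setoid (ℝ × ℝ) where
  r p q := ∃ j k : ℤ, q = ((-1 : ℝ) ^ k * p.1 + j * m, p.2 + k * n)
  iseqv := by
    refine ⟨fun p => ⟨0, 0, by simp⟩, ?_, ?_⟩
    · rintro p q ⟨j, k, rfl⟩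
      rcases Int.even_or_odd k with hk | hk
      · refine ⟨-j, -k, ?_⟩
        simp [hk.neg_one_zpow]
      · refine ⟨j, -k, ?_⟩
        simp [hk.neg_one_zpow]
    · rintro p q r ⟨j, k, rfl⟩ ⟨j', k', rfl⟩
      rcases Int.even_or_odd k' with hk | hk
      · refine ⟨j + j', k + k', ?_⟩
        rw [zpow_add₀ (by norm_num), hk.neg_one_zpow]
        ext <;> push_cast <;> ring
      · refine ⟨j' - j, k + k', ?_⟩
        rw [zpow_add₀ (by norm_num), hk.neg_one_zpow]
        ext <;> push_cast <;> ring

/-- The Klein bottle of width `m` and height `n`, with the quotient topology of the plane. -/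
def Klein (m n : ℕ) : Type := Quotient (kleinSetoid m n)

instance (m n : ℕ) : TopologicalSpace (Klein m n) :=
  inferInstanceAs (TopologicalSpace (Quotient (kleinSetoid m n)))

/-- The covering map from the plane to the Klein bottle. -/
def kleinProj (m n : ℕ) : C(ℝ × ℝ, Klein m n) :=
  ⟨Quotient.mk (kleinSetoid m n), continuous_quotient_mk'⟩

/-- Two points of the strip `ℝ × [0, n]` are identified if they differ by a horizontal translation
by a multiple of `m`.  On the rectangle `[0, m] × [0, n]` this glues `(0, y)` to `(m, y)`. -/
def cylinderSetoid (m n : ℕ) : Setoid (ℝ × Set.Icc (0 : ℝ) n) where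
  r p q := ∃ j : ℤ, q = (p.1 + j * m, p.2)
  iseqv := by
    refine ⟨fun p => ⟨0, by simp⟩, ?_, ?_⟩
    · rintro p q ⟨j, rfl⟩
      exact ⟨-j, by simp⟩
    · rintro p q r ⟨j, rfl⟩ ⟨j', rfl⟩
      refine ⟨j + j', ?_⟩
      ext
      · push_cast; ring
      · rfl

/-- The cylinder of circumference `m` and height `n`. -/
def Cylinder (m n : ℕ) : Type := Quotient (cylinderSetoid m n)

instance (m n : ℕ) : TopologicalSpace (Cylinder m n) :=
  inferInstanceAs (TopologicalSpace (Quotient (cylinderSetoid m n)))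

/-- The covering map from the strip `ℝ × [0, n]` to the cylinder. -/
def cylinderProj (m n : ℕ) : C(ℝ × Set.Icc (0 : ℝ) n, Cylinder m n) :=
  ⟨Quotient.mk (cylinderSetoid m n), continuous_quotient_mk'⟩

/-- The standard quotient map from the cylinder to the Klein bottle, induced by the inclusion of
the strip `ℝ × [0, n]` in the plane.  It glues the two boundary circles of the cylinder. -/
def cylinderToKlein (m n : ℕ) : C(Cylinder m n, Klein m n) where
  toFun := Quotient.lift (s := cylinderSetoid m n)
    (fun p => kleinProj m n (p.1, (p.2 : ℝ)))
    (by
      rintro p q ⟨j, rfl⟩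
      exact Quotient.sound (s := kleinSetoid m n) ⟨j, 0, by simp⟩)
  continuous_toFun := by
    refine Continuous.quotient_lift (s := cylinderSetoid m n) ?_ _
    fun_prop

/-- The squares of the board, which are the vertices of the pseudograph `K_{m,n}`. -/
abbrev Square (m n : ℕ) : Type :=
  {v : ℤ × ℤ // (0 ≤ v.1 ∧ v.1 < m) ∧ (0 ≤ v.2 ∧ v.2 < n)}

/-- The knight moves `(c, d)`, that is `{|c|, |d|} = {1, 2}`. -/
abbrev Move : Type :=
  {c : ℤ × ℤ // (|c.1| = 1 ∧ |c.2| = 2) ∨ (|c.1| = 2 ∧ |c.2| = 1)}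

/-- The centre of the unit square of the plane with lower left corner `v`. -/
def cellCenter (v : ℤ × ℤ) : ℝ × ℝ := ((v.1 : ℝ) + 1 / 2, (v.2 : ℝ) + 1 / 2)

section Board

variable {m n : ℕ} [NeZero m] [NeZero n]

/-- The square of the board onto which the covering map sends the unit square of the plane with
lower left corner `v`.  The reflection `x ↦ -x` maps the unit interval starting at `a` to the one
starting at `-1 - a`. -/
def reduce (m n : ℕ) [NeZero m] [NeZero n] (v : ℤ × ℤ) : Square m n :=
  ⟨((if Even (v.2 / (n : ℤ)) then v.1 else -1 - v.1) % (m : ℤ), v.2 % (n : ℤ)), by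
    have hm : (0 : ℤ) < m := by exact_mod_cast Nat.pos_of_ne_zero (NeZero.ne m)
    have hn : (0 : ℤ) < n := by exact_mod_cast Nat.pos_of_ne_zero (NeZero.ne n)
    exact ⟨⟨Int.emod_nonneg _ hm.ne', Int.emod_lt_of_pos _ hm⟩,
      ⟨Int.emod_nonneg _ hn.ne', Int.emod_lt_of_pos _ hn⟩⟩⟩

/-- The square reached from `u` by the move `c`. -/
def step (u : Square m n) (c : Move) : Square m n := reduce m n (u.1 + c.1)

/-- The move that undoes the move `c` from `u`.  Its horizontal component keeps the sign of that of
`c` if the move crosses the reflecting seam an odd number of times. -/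
def reverseMove (u : Square m n) (c : Move) : Move :=
  ⟨(if Even ((u.1.2 + c.1.2) / (n : ℤ)) then -c.1.1 else c.1.1, -c.1.2), by
    have h := c.2
    split_ifs <;> simpa using h⟩

/-- The edge of the pseudograph traversed by the move `c` from `u`: this move and its reverse,
as an unordered pair.  Distinct edges may join the same squares. -/
def edge (u : Square m n) (c : Move) : Sym2 (Square m n × Move) :=
  s((u, c), (step u c, reverseMove u c))

/-- Walks in the pseudograph `K_{m,n}`. -/
inductive Walk (m n : ℕ) [NeZero m] [NeZero n] : Square m n → Square m n → Type
  | nil (u : Square m n) : Walk m n u u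
  | cons {w : Square m n} (u : Square m n) (c : Move) (p : Walk m n (step u c) w) : Walk m n u w

/-- The squares visited by a walk, in order, without the final one. -/
def Walk.squares : {u w : Square m n} → Walk m n u w → List (Square m n)
  | _, _, .nil _ => []
  | _, _, .cons u _ p => u :: p.squares

/-- The edges traversed by a walk, in order. -/
def Walk.edges : {u w : Square m n} → Walk m n u w → List (Sym2 (Square m n × Move))
  | _, _, .nil _ => []
  | _, _, .cons u c p => edge u c :: p.edges

/-- A closed walk is a (closed) knight's tour if it is a Hamiltonian cycle: it visits every square
exactly once and traverses no edge twice. -/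
def Walk.IsTour {u : Square m n} (p : Walk m n u u) : Prop :=
  p.squares.Nodup ∧ (∀ v, v ∈ p.squares) ∧ p.edges.Nodup

/-- The point of the Klein bottle at the centre of a square of the board. -/
def center (u : Square m n) : Klein m n := kleinProj m n (cellCenter u.1)

theorem kleinProj_cellCenter (v : ℤ × ℤ) :
    kleinProj m n (cellCenter v) = center (reduce m n v) := by
  have h1 := Int.emod_add_mul_ediv v.2 n
  refine Quotient.sound (s := kleinSetoid m n) ?_
  rcases Int.even_or_odd (v.2 / (n : ℤ)) with hk | hk
  · have h2 := Int.emod_add_mul_ediv v.1 m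
    refine ⟨-(v.1 / m), -(v.2 / n), ?_⟩
    rw [hk.neg.neg_one_zpow]
    simp only [cellCenter, reduce, if_pos hk]
    ext
    · have : ((v.1 % m : ℤ) : ℝ) + m * ((v.1 / m : ℤ) : ℝ) = v.1 := by exact_mod_cast h2
      push_cast; linarith
    · have : ((v.2 % n : ℤ) : ℝ) + n * ((v.2 / n : ℤ) : ℝ) = v.2 := by exact_mod_cast h1
      push_cast; linarith
  · have h2 := Int.emod_add_mul_ediv (-1 - v.1) m
    refine ⟨-((-1 - v.1) / m), -(v.2 / n), ?_⟩
    rw [hk.neg.neg_one_zpow]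
    simp only [cellCenter, reduce, if_neg (Int.not_even_iff_odd.2 hk)]
    ext
    · have : (((-1 - v.1) % m : ℤ) : ℝ) + m * (((-1 - v.1) / m : ℤ) : ℝ) = -1 - v.1 := by
        exact_mod_cast h2
      push_cast; linarith
    · have : ((v.2 % n : ℤ) : ℝ) + n * ((v.2 / n : ℤ) : ℝ) = v.2 := by exact_mod_cast h1
      push_cast; linarith

/-- The path in the Klein bottle that realizes the move `c` from `u`: the image of the straight
segment in the plane from the centre of `u` to the centre of `u + c`. -/
def movePath (u : Square m n) (c : Move) : Path (center u) (center (step u c)) :=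
  ((Path.segment (cellCenter u.1) (cellCenter (u.1 + c.1))).map (kleinProj m n).continuous).cast
    rfl (kleinProj_cellCenter _).symm

/-- The path in the Klein bottle that realizes a walk. -/
def Walk.toPath : {u w : Square m n} → Walk m n u w → Path (center u) (center w)
  | _, _, .nil u => Path.refl (center u)
  | _, _, .cons u c p => (movePath u c).trans p.toPath

/-- The square `(0, 0)`. -/
def origin (m n : ℕ) [NeZero m] [NeZero n] : Square m n :=
  ⟨(0, 0), by
    have hm := Nat.pos_of_ne_zero (NeZero.ne m)
    have hn := Nat.pos_of_ne_zero (NeZero.ne n)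
    simpa using ⟨hm, hn⟩⟩

/-- The base point `(1/2, 1/2)` of the cylinder. -/
def cylinderBase (m n : ℕ) [NeZero n] : Cylinder m n :=
  cylinderProj m n (1 / 2, ⟨1 / 2, by
    have hn : (1 : ℝ) ≤ n := by exact_mod_cast Nat.pos_of_ne_zero (NeZero.ne n)
    constructor <;> linarith⟩)

theorem cylinderToKlein_base (m n : ℕ) [NeZero m] [NeZero n] :
    cylinderToKlein m n (cylinderBase m n) = center (origin m n) := by
  change kleinProj m n (1 / 2, 1 / 2) = kleinProj m n (cellCenter (0, 0))
  simp [cellCenter]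

/-- A closed walk at `(0, 0)` is cylindrical if the element of the fundamental group of the Klein
bottle that it realizes is the image of a generator of the fundamental group of the cylinder. -/
def Walk.IsCylindrical (p : Walk m n (origin m n) (origin m n)) : Prop :=
  ∃ g : FundamentalGroup (Cylinder m n) (cylinderBase m n),
    Subgroup.zpowers g = ⊤ ∧
    FundamentalGroup.mapOfEq (cylinderToKlein m n) (cylinderToKlein_base m n) g =
      FundamentalGroup.fromPath (Path.Homotopic.Quotient.mk p.toPath)

end Board

end KnightTour

end

/-! The plane covers the Klein bottle and the strip covers the cylinder. The fundamental group of
the cylinder is ℤ, and a loop is determined up to homotopy by the endpoint of its lift, so a closed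
walk is cylindrical exactly when its lift to the plane from `(0, 0)` ends at `(±m, 0)`
(`Walk.isCylindrical_iff`). From there on everything concerns lattice paths.

Obstructions: each move changes the parity of `x + y`, so `m * n` moves ending at `(±m, 0)` force `m
* n ≡ m` mod 2, which fails for `m` odd and `n` even. On the 2 × 2 board every move with vertical
component ±2 is a loop, so a tour uses only moves with horizontal component ±2; four of these give a
displacement divisible by 4, not ±2.

Existence: horizontal translates of a cylindrical tour path of the `m × n` board concatenate to one
of the `k * m × n` board (`IsTourPath.iterate`). So it is enough to treat widths 1 and 2, together
with the exceptional heights: height 1 with odd width, and height 2, where the 2 × 2 board is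
unavailable as a base and the widths 4 and `4 * k + 6` are used instead. -/

noncomputable section

namespace KnightTour

/-! ### Deck groups and covering maps. -/

/-- The infinite cyclic group of horizontal translations by multiples of `m`. -/
def CylinderDeck (_m : ℕ) : Type := ℤ

instance (m : ℕ) : AddCommGroup (CylinderDeck m) := inferInstanceAs (AddCommGroup ℤ)

/-- The action depends on `m`, which is why the deck group is a copy of ℤ indexed by `m`. -/
instance (m n : ℕ) : AddAction (CylinderDeck m) (ℝ × Set.Icc (0 : ℝ) n) where
  vadd j p := (p.1 + ((show ℤ from j : ℤ) : ℝ) * m, p.2)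
  zero_vadd p := by
    change (p.1 + ((0 : ℤ) : ℝ) * m, p.2) = p
    simp
  add_vadd i j p := by
    have key : ∀ a b : ℤ, (p.1 + ((a + b : ℤ) : ℝ) * m, p.2) =
        (p.1 + (b : ℝ) * m + (a : ℝ) * m, p.2) := fun a b => by
      push_cast
      congr 1
      ring
    exact key i j

theorem abs_int_mul_lt_one {j : ℤ} {m : ℕ} (hm : 0 < m) (h : |(j : ℝ) * m| < 1) : j = 0 := by
  have h1 : |j * (m : ℤ)| < 1 := by exact_mod_cast h
  have h2 : j * (m : ℤ) = 0 := Int.abs_lt_one_iff.1 h1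
  rcases mul_eq_zero.1 h2 with h | h
  · exact h
  · omega

theorem isAddQuotientCoveringMap_cylinderProj (m n : ℕ) [NeZero m] :
    IsAddQuotientCoveringMap (cylinderProj m n) (CylinderDeck m) where
  toIsQuotientMap := isQuotientMap_quotient_mk'
  continuous_const_vadd j := by
    change Continuous fun p : ℝ × Set.Icc (0 : ℝ) n => (p.1 + ((show ℤ from j : ℤ) : ℝ) * m, p.2)
    fun_prop
  apply_eq_iff_mem_orbit {p q} := by
    constructor
    · intro h
      obtain ⟨j, hj⟩ := (cylinderSetoid m n).symm' (Quotient.exact (s := cylinderSetoid m n) h)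
      exact ⟨(show CylinderDeck m from j), hj.symm⟩
    · rintro ⟨j, rfl⟩
      exact Quotient.sound (s := cylinderSetoid m n) ((cylinderSetoid m n).symm' ⟨(show ℤ from j), rfl⟩)
  disjoint p := by
    -- Two points of a ball of radius 1/2 are less than 1 apart, while a nontrivial translation
    -- moves points by at least `m ≥ 1`.
    refine ⟨Metric.ball p.1 (1 / 2) ×ˢ Set.univ,
      prod_mem_nhds (Metric.ball_mem_nhds _ (by norm_num)) Filter.univ_mem, ?_⟩
    rintro j ⟨_, ⟨q, ⟨hq, -⟩, rfl⟩, hq', -⟩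
    refine abs_int_mul_lt_one (Nat.pos_of_ne_zero (NeZero.ne m)) (j := (show ℤ from j)) ?_
    change dist (q.1 + ((show ℤ from j : ℤ) : ℝ) * m) p.1 < 1 / 2 at hq'
    change dist q.1 p.1 < 1 / 2 at hq
    rw [Real.dist_eq, abs_lt] at hq hq'
    rw [abs_lt]
    constructor <;> linarith [hq.1, hq.2, hq'.1, hq'.2]

/-- The group of glide reflections and translations whose orbit space is the Klein bottle. -/
def kleinDeck (m n : ℕ) : Subgroup (Equiv.Perm (ℝ × ℝ)) where
  carrier := {φ | ∃ j k : ℤ, ∀ p, φ p = ((-1 : ℝ) ^ k * p.1 + j * m, p.2 + k * n)}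
  one_mem' := ⟨0, 0, by simp⟩
  mul_mem' := by
    rintro φ ψ ⟨j, k, h⟩ ⟨j', k', h'⟩
    rcases Int.even_or_odd k with hk | hk
    · refine ⟨j + j', k + k', fun p => ?_⟩
      rw [Equiv.Perm.mul_apply, h, h', zpow_add₀ (by norm_num), hk.neg_one_zpow]
      ext <;> push_cast <;> ring
    · refine ⟨j - j', k + k', fun p => ?_⟩
      rw [Equiv.Perm.mul_apply, h, h', zpow_add₀ (by norm_num), hk.neg_one_zpow]
      ext <;> push_cast <;> ring
  inv_mem' := by
    rintro φ ⟨j, k, h⟩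
    rcases Int.even_or_odd k with hk | hk
    · refine ⟨-j, -k, fun p => ?_⟩
      rw [Equiv.Perm.inv_eq_iff_eq, h, hk.neg_one_zpow, hk.neg.neg_one_zpow]
      ext <;> push_cast <;> ring
    · refine ⟨j, -k, fun p => ?_⟩
      rw [Equiv.Perm.inv_eq_iff_eq, h, hk.neg_one_zpow, hk.neg.neg_one_zpow]
      ext <;> push_cast <;> ring

/-- The glide reflection or translation with parameters `j` and `k`. -/
def glide (m n : ℕ) (j k : ℤ) : Equiv.Perm (ℝ × ℝ) where
  toFun p := ((-1 : ℝ) ^ k * p.1 + j * m, p.2 + k * n)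
  invFun p := ((-1 : ℝ) ^ k * (p.1 - j * m), p.2 - k * n)
  left_inv p := by
    rcases Int.even_or_odd k with hk | hk <;> simp [hk.neg_one_zpow]
  right_inv p := by
    rcases Int.even_or_odd k with hk | hk <;> simp [hk.neg_one_zpow]

theorem isQuotientCoveringMap_kleinProj (m n : ℕ) [NeZero m] [NeZero n] :
    IsQuotientCoveringMap (kleinProj m n) (kleinDeck m n) where
  toIsQuotientMap := isQuotientMap_quotient_mk'
  continuous_const_smul := by
    rintro ⟨φ, j, k, h⟩
    have hc : Continuous fun p : ℝ × ℝ => ((-1 : ℝ) ^ k * p.1 + j * m, p.2 + k * n) := by fun_prop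
    exact hc.congr fun p => (h p).symm
  apply_eq_iff_mem_orbit {p q} := by
    constructor
    · intro h
      obtain ⟨j, k, hj⟩ := (kleinSetoid m n).symm' (Quotient.exact (s := kleinSetoid m n) h)
      exact ⟨⟨glide m n j k, j, k, fun _ => rfl⟩, hj.symm⟩
    · rintro ⟨⟨φ, j, k, h⟩, rfl⟩
      exact Quotient.sound (s := kleinSetoid m n) ((kleinSetoid m n).symm' ⟨j, k, h q⟩)
  disjoint p := by
    refine ⟨Metric.ball p.1 (1 / 2) ×ˢ Metric.ball p.2 (1 / 2),
      prod_mem_nhds (Metric.ball_mem_nhds _ (by norm_num)) (Metric.ball_mem_nhds _ (by norm_num)),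
      ?_⟩
    rintro ⟨φ, j, k, h⟩ ⟨_, ⟨q, ⟨hq1, hq2⟩, rfl⟩, hq'⟩
    change φ q ∈ _ at hq'
    rw [h q] at hq'
    obtain ⟨hq1', hq2'⟩ := hq'
    simp only [Metric.mem_ball, Real.dist_eq, abs_lt] at hq1 hq2 hq1' hq2'
    -- The vertical shift must be excluded first: only for `k = 0` is the horizontal motion a
    -- translation rather than a reflection.
    have hk : k = 0 := by
      refine abs_int_mul_lt_one (Nat.pos_of_ne_zero (NeZero.ne n)) ?_
      rw [abs_lt]
      constructor <;> linarith [hq2.1, hq2.2, hq2'.1, hq2'.2]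
    subst hk
    have hj : j = 0 := by
      refine abs_int_mul_lt_one (Nat.pos_of_ne_zero (NeZero.ne m)) ?_
      rw [zpow_zero, one_mul] at hq1'
      rw [abs_lt]
      constructor <;> linarith [hq1.1, hq1.2, hq1'.1, hq1'.2]
    subst hj
    refine Subtype.ext (Equiv.ext fun x => ?_)
    simpa using h x

/-! ### Lifting walks to the plane. -/

section Lift

variable {m n : ℕ}

/-- The displacement in the plane of the move `c` from the unit square at `v`, obtained by
reflecting `c` if `v` lies on a sheet of odd height. -/
def liftMove (n : ℕ) (v c : ℤ × ℤ) : ℤ × ℤ :=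
  (if Even (v.2 / (n : ℤ)) then c.1 else -c.1, c.2)

theorem liftMove_liftMove (v c : ℤ × ℤ) : liftMove n v (liftMove n v c) = c := by
  unfold liftMove
  split_ifs <;> simp

theorem liftMove_isMove (v : ℤ × ℤ) {c : ℤ × ℤ}
    (h : (|c.1| = 1 ∧ |c.2| = 2) ∨ (|c.1| = 2 ∧ |c.2| = 1)) :
    (|(liftMove n v c).1| = 1 ∧ |(liftMove n v c).2| = 2) ∨
      (|(liftMove n v c).1| = 2 ∧ |(liftMove n v c).2| = 1) := by
  unfold liftMove
  split_ifs <;> simpa using h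

theorem segment_cellCenter (v w : ℤ × ℤ) (t : unitInterval) :
    Path.segment (cellCenter v) (cellCenter w) t =
      ((v.1 : ℝ) + 1 / 2 + t * (w.1 - v.1), (v.2 : ℝ) + 1 / 2 + t * (w.2 - v.2)) := by
  rw [Path.segment_apply, AffineMap.lineMap_apply]
  ext <;> simp [cellCenter] <;> ring

variable [NeZero m] [NeZero n]

/-- Crossing seams adds sheet heights, so reflections compose by parity; reflecting the move on odd
sheets compensates for the reflection made by `reduce`. -/
theorem step_reduce (v : ℤ × ℤ) (c : Move) :
    step (reduce m n v) c = reduce m n (v + liftMove n v c.1) := by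
  have hn : (n : ℤ) ≠ 0 := by exact_mod_cast NeZero.ne n
  obtain ⟨a, b⟩ := v
  obtain ⟨⟨c, d⟩, hc⟩ := c
  have hb : b + d = (b % n + d) + n * (b / n) := by linarith [Int.emod_add_mul_ediv b n]
  have h2 : (b + d) % (n : ℤ) = (b % n + d) % n := by rw [hb, Int.add_mul_emod_self_left]
  have h3 : (b + d) / (n : ℤ) = (b % n + d) / n + b / n := by
    rw [hb, Int.add_mul_ediv_left _ _ hn]
  apply Subtype.ext
  simp only [step, reduce, liftMove, Prod.mk_add_mk, h2, h3, Int.even_add]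
  refine Prod.ext ?_ rfl
  have hx : ∀ x : ℤ, x % m = x - m * (x / m) := fun x => by
    linarith [Int.emod_add_mul_ediv x m]
  by_cases h : Even (b / (n : ℤ)) <;> by_cases h' : Even ((b % n + d) / (n : ℤ)) <;>
    simp only [h, h', if_true, if_false, iff_true, iff_false, not_true] <;>
    refine (Int.modEq_iff_dvd.2 ?_ : _ ≡ _ [ZMOD m])
  · exact ⟨a / m, by rw [hx a]; ring⟩
  · exact ⟨-(a / m), by rw [hx a]; ring⟩
  · exact ⟨(-1 - a) / m, by rw [hx (-1 - a)]; ring⟩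
  · exact ⟨-((-1 - a) / m), by rw [hx (-1 - a)]; ring⟩

/-- The deck transformation taking the cell `v` to its representative on the board takes the whole
segment to the segment of the move. -/
theorem kleinProj_segment (v c : ℤ × ℤ) (t : unitInterval) :
    kleinProj m n (Path.segment (cellCenter v) (cellCenter (v + liftMove n v c)) t) =
      kleinProj m n (Path.segment (cellCenter (reduce m n v).1)
        (cellCenter ((reduce m n v).1 + c)) t) := by
  have h1 := Int.emod_add_mul_ediv v.2 n
  have e2 : ((v.2 % n : ℤ) : ℝ) = v.2 - n * ((v.2 / n : ℤ) : ℝ) := by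
    rw [eq_sub_iff_add_eq]; exact_mod_cast h1
  rw [segment_cellCenter, segment_cellCenter]
  refine Quotient.sound (s := kleinSetoid m n) ?_
  rcases Int.even_or_odd (v.2 / (n : ℤ)) with hk | hk
  · have h2 := Int.emod_add_mul_ediv v.1 m
    refine ⟨-(v.1 / m), -(v.2 / n), ?_⟩
    have e1 : ((v.1 % m : ℤ) : ℝ) = v.1 - m * ((v.1 / m : ℤ) : ℝ) := by
      rw [eq_sub_iff_add_eq]; exact_mod_cast h2
    simp only [hk.neg.neg_one_zpow, reduce, liftMove, if_pos hk, Prod.fst_add, Prod.snd_add]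
    push_cast
    rw [e1, e2]
    ext <;> ring
  · have h2 := Int.emod_add_mul_ediv (-1 - v.1) m
    refine ⟨-((-1 - v.1) / m), -(v.2 / n), ?_⟩
    have e1 : (((-1 - v.1) % m : ℤ) : ℝ) = -1 - v.1 - m * (((-1 - v.1) / m : ℤ) : ℝ) := by
      rw [eq_sub_iff_add_eq]; exact_mod_cast h2
    simp only [hk.neg.neg_one_zpow, reduce, liftMove, if_neg (Int.not_even_iff_odd.2 hk),
      Prod.fst_add, Prod.snd_add]
    push_cast
    rw [e1, e2]
    ext <;> ring

/-- The unit square of the plane at which the lift of a walk to the plane ends, if it starts at the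
unit square at `v`. -/
def Walk.liftEnd : {u w : Square m n} → Walk m n u w → ℤ × ℤ → ℤ × ℤ
  | _, _, .nil _, v => v
  | _, _, .cons _ c p, v => p.liftEnd (v + liftMove n v c.1)

theorem Walk.exists_lift {u w : Square m n} (p : Walk m n u w) (v : ℤ × ℤ)
    (hv : reduce m n v = u) :
    ∃ Γ : Path (cellCenter v) (cellCenter (p.liftEnd v)),
      ∀ t, kleinProj m n (Γ t) = p.toPath t := by
  induction p generalizing v with
  | nil u =>
    refine ⟨Path.refl _, fun t => ?_⟩
    subst hv
    exact kleinProj_cellCenter v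
  | cons u c p ih =>
    subst hv
    obtain ⟨Γ, hΓ⟩ := ih _ (step_reduce v c).symm
    refine ⟨(Path.segment _ _).trans Γ, fun t => ?_⟩
    have e1 := Path.trans_apply (Path.segment (cellCenter v) (cellCenter (v + liftMove n v c.1))) Γ t
    have e2 := Path.trans_apply (movePath (reduce m n v) c) p.toPath t
    refine (congrArg (kleinProj m n) e1).trans (Eq.trans ?_ e2.symm)
    split_ifs
    · exact kleinProj_segment v c.1 _
    · exact hΓ _

end Lift

/-! ### Cylindrical loops in terms of lifted endpoints. -/

section Cylindrical

variable {m n : ℕ} [NeZero n]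

/-- The point of the strip with horizontal coordinate `x` and vertical coordinate `1 / 2`. -/
def stripPoint (n : ℕ) [NeZero n] (x : ℝ) : ℝ × Set.Icc (0 : ℝ) n :=
  (x, ⟨1 / 2, by
    have hn : (1 : ℝ) ≤ n := by exact_mod_cast Nat.pos_of_ne_zero (NeZero.ne n)
    constructor <;> linarith⟩)

/-- The generators of ℤ are ±1. The opposite group appears because the covering-space isomorphism
has the opposite of the deck group as its target. -/
theorem zpowers_eq_top_iff_of_mulEquiv_int {G : Type*} [Group G] (e : G ≃* (Multiplicative ℤ)ᵐᵒᵖ)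
    (g : G) : Subgroup.zpowers g = ⊤ ↔
      (e g).unop.toAdd = 1 ∨ (e g).unop.toAdd = -1 := by
  have hpow : ∀ (h : G) (k : ℤ), (e (h ^ k)).unop.toAdd = k * (e h).unop.toAdd := by
    intro h k
    rw [map_zpow, MulOpposite.unop_zpow, toAdd_zpow, smul_eq_mul]
  rw [Subgroup.eq_top_iff']
  constructor
  · intro h
    obtain ⟨k, hk⟩ := Subgroup.mem_zpowers_iff.1 (h (e.symm (MulOpposite.op (Multiplicative.ofAdd 1))))
    have h1 := hpow g k
    rw [hk, e.apply_symm_apply] at h1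
    exact Int.isUnit_iff.1 (IsUnit.of_mul_eq_one k ((mul_comm _ _).trans h1.symm))
  · intro h x
    refine Subgroup.mem_zpowers_iff.2 ⟨(e x).unop.toAdd * (e g).unop.toAdd, e.injective ?_⟩
    apply MulOpposite.unop_injective
    apply Multiplicative.toAdd.injective
    rw [hpow]
    rcases h with h | h <;> rw [h] <;> ring

theorem exists_cylinder_loop_of_lift (z : ℤ)
    (Γ : Path (stripPoint n (1 / 2)) (stripPoint n (1 / 2 + z * m))) :
    ∃ γ : Path (cylinderBase m n) (cylinderBase m n), ∀ t, cylinderProj m n (Γ t) = γ t := by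
  refine ⟨(Γ.map (cylinderProj m n).continuous).cast rfl ?_, fun t => rfl⟩
  exact Quotient.sound (s := cylinderSetoid m n) ⟨z, rfl⟩

/-- The inclusion of the strip in the plane. -/
def stripInclusion (n : ℕ) : C(ℝ × Set.Icc (0 : ℝ) n, ℝ × ℝ) := ⟨fun p => (p.1, p.2), by fun_prop⟩

variable [NeZero m]

theorem zpowers_cylinder_loop_eq_top_iff (γ : Path (cylinderBase m n) (cylinderBase m n)) (z : ℤ)
    (Γ : Path (stripPoint n (1 / 2)) (stripPoint n (1 / 2 + z * m)))
    (hΓ : ∀ t, cylinderProj m n (Γ t) = γ t) :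
    Subgroup.zpowers (FundamentalGroup.fromPath (Path.Homotopic.Quotient.mk γ)) = ⊤ ↔
      z = 1 ∨ z = -1 := by
  have hC := isAddQuotientCoveringMap_cylinderProj m n
  let e : cylinderProj m n ⁻¹' {cylinderBase m n} := ⟨stripPoint n (1 / 2), rfl⟩
  -- This makes the strip simply connected, so that the fundamental group of the cylinder is the
  -- whole deck group.
  have : ContractibleSpace (Set.Icc (0 : ℝ) n) :=
    (convex_Icc (0 : ℝ) n).contractibleSpace ⟨0, by simp⟩
  have h1 : hC.fundamentalGroupEquiv e
      (FundamentalGroup.fromPath (Path.Homotopic.Quotient.mk γ)) =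
      MulOpposite.op (Multiplicative.ofAdd (show CylinderDeck m from z)) := by
    refine hC.fundamentalGroupToMulOpposite_apply_eq_Iff.2 ?_
    have h2 : Γ.toContinuousMap = hC.isCoveringMap.liftPath γ (stripPoint n (1 / 2))
        γ.source := (hC.isCoveringMap.eq_liftPath_iff' _).2 ⟨funext hΓ, Γ.source⟩
    have h3 : Γ.toContinuousMap 1 = stripPoint n (1 / 2 + z * m) := Γ.target
    rw [h2] at h3
    exact h3.symm
  exact (zpowers_eq_top_iff_of_mulEquiv_int (hC.fundamentalGroupEquiv e) _).trans
    (iff_of_eq (congrArg (fun x : (Multiplicative ℤ)ᵐᵒᵖ =>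
      x.unop.toAdd = 1 ∨ x.unop.toAdd = -1) h1))

theorem exists_lift_cylinder_loop (γ : Path (cylinderBase m n) (cylinderBase m n)) :
    ∃ (z : ℤ) (Γ : Path (stripPoint n (1 / 2)) (stripPoint n (1 / 2 + z * m))),
      ∀ t, cylinderProj m n (Γ t) = γ t := by
  have hC := isAddQuotientCoveringMap_cylinderProj m n
  obtain ⟨Γ, hΓ, h0⟩ := hC.isCoveringMap.exists_path_lifts γ (stripPoint n (1 / 2)) γ.source
  have h1 : cylinderProj m n (stripPoint n (1 / 2)) = cylinderProj m n (Γ 1) :=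
    (γ.target.symm).trans (congrFun hΓ 1).symm
  obtain ⟨z, hz⟩ := Quotient.exact (s := cylinderSetoid m n) h1
  exact ⟨z, ⟨Γ, h0, hz⟩, congrFun hΓ⟩

/-- Both loops lift to the plane from the same cell centre. Homotopic loops have lifts with equal
endpoints; conversely, lifts with equal endpoints are homotopic because the plane is simply
connected, and the homotopy projects. -/
theorem mapOfEq_cylinderToKlein_eq_iff (p : Walk m n (origin m n) (origin m n)) (z : ℤ)
    (γ : Path (cylinderBase m n) (cylinderBase m n))
    (Γ : Path (stripPoint n (1 / 2)) (stripPoint n (1 / 2 + z * m)))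
    (hΓ : ∀ t, cylinderProj m n (Γ t) = γ t) :
    FundamentalGroup.mapOfEq (cylinderToKlein m n) (cylinderToKlein_base m n)
        (FundamentalGroup.fromPath (Path.Homotopic.Quotient.mk γ)) =
      FundamentalGroup.fromPath (Path.Homotopic.Quotient.mk p.toPath) ↔
    p.liftEnd (0, 0) = (z * m, 0) := by
  have hK := (isQuotientCoveringMap_kleinProj m n).isCoveringMap
  have hr : reduce m n (0, 0) = origin m n := by
    apply Subtype.ext; simp [reduce, origin]
  obtain ⟨Λ, hΛ⟩ := p.exists_lift (0, 0) hr
  have hlift : ∀ t, kleinProj m n (stripInclusion n (Γ t)) = cylinderToKlein m n (γ t) := fun t => by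
    rw [← hΓ]; rfl
  have hstart : stripInclusion n (stripPoint n (1 / 2)) = cellCenter (0, 0) := by
    simp [stripInclusion, stripPoint, cellCenter]
  have hend : stripInclusion n (stripPoint n (1 / 2 + z * m)) = cellCenter (z * m, 0) := by
    simp [stripInclusion, stripPoint, cellCenter, add_comm]
  let δ : Path (center (origin m n)) (center (origin m n)) :=
    (γ.map (cylinderToKlein m n).continuous).cast (cylinderToKlein_base m n).symm
      (cylinderToKlein_base m n).symm
  have hmap : FundamentalGroup.mapOfEq (cylinderToKlein m n) (cylinderToKlein_base m n)
        (FundamentalGroup.fromPath (Path.Homotopic.Quotient.mk γ)) =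
      FundamentalGroup.fromPath (Path.Homotopic.Quotient.mk δ) := by
    rw [FundamentalGroup.mapOfEq_apply]
    rfl
  let Δ : Path (cellCenter (0, 0)) (cellCenter (z * m, 0)) :=
    (Γ.map (stripInclusion n).continuous).cast hstart.symm hend.symm
  have hΔ : ∀ t, kleinProj m n (Δ t) = δ t := hlift
  rw [hmap]
  constructor
  · intro h
    have h1 : Path.Homotopic δ p.toPath := Path.Homotopic.Quotient.exact h
    have e1 : Δ.toContinuousMap = hK.liftPath δ (cellCenter (0, 0)) δ.source :=
      (hK.eq_liftPath_iff' _).2 ⟨funext hΔ, Δ.source⟩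
    have e2 : Λ.toContinuousMap = hK.liftPath p.toPath (cellCenter (0, 0)) p.toPath.source :=
      (hK.eq_liftPath_iff' _).2 ⟨funext hΛ, Λ.source⟩
    have h2 := hK.liftPath_apply_one_eq_of_homotopicRel h1 (cellCenter (0, 0)) δ.source
      p.toPath.source
    have h3 : cellCenter (z * m, 0) = cellCenter (p.liftEnd (0, 0)) :=
      Δ.target.symm.trans ((DFunLike.congr_fun e1 1).trans
        (h2.trans ((DFunLike.congr_fun e2 1).symm.trans Λ.target)))
    simp only [cellCenter, Prod.mk.injEq, add_left_inj, Int.cast_inj] at h3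
    exact Prod.ext h3.1.symm h3.2.symm
  · intro h
    refine congrArg _ (Path.Homotopic.Quotient.eq.2 ?_)
    have h1 : Path.Homotopic Δ (Λ.cast rfl (by rw [h])) :=
      SimplyConnectedSpace.paths_homotopic _ _
    have h2 := (h1.map (kleinProj m n)).pathCast (x₂ := center (origin m n))
      (x₃ := center (origin m n)) (δ.source.symm.trans ((hΔ 0).symm.trans (by rw [Δ.source])))
      (δ.target.symm.trans ((hΔ 1).symm.trans (by rw [Δ.target])))
    convert h2 using 1
    · ext t; exact (hΔ t).symm
    · ext t; exact (hΛ t).symm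

/-- A closed walk is cylindrical if and only if its lift to the plane ends at the translate of its
starting point by the circumference of the cylinder, in one of the two directions. -/
theorem Walk.isCylindrical_iff (p : Walk m n (origin m n) (origin m n)) :
    p.IsCylindrical ↔ p.liftEnd (0, 0) = ((m : ℤ), 0) ∨ p.liftEnd (0, 0) = (-(m : ℤ), 0) := by
  constructor
  · rintro ⟨g, hg, h⟩
    obtain ⟨γ, rfl⟩ := Path.Homotopic.Quotient.mk_surjective g
    obtain ⟨z, Γ, hΓ⟩ := exists_lift_cylinder_loop γ
    have h1 := (mapOfEq_cylinderToKlein_eq_iff p z γ Γ hΓ).1 h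
    rcases (zpowers_cylinder_loop_eq_top_iff γ z Γ hΓ).1 hg with rfl | rfl
    · left; simpa using h1
    · right; simpa using h1
  · intro h
    obtain ⟨z, hz, h⟩ : ∃ z : ℤ, (z = 1 ∨ z = -1) ∧ p.liftEnd (0, 0) = (z * m, 0) := by
      rcases h with h | h
      · exact ⟨1, Or.inl rfl, by simpa using h⟩
      · exact ⟨-1, Or.inr rfl, by simpa using h⟩
    have : ContractibleSpace (Set.Icc (0 : ℝ) n) :=
      (convex_Icc (0 : ℝ) n).contractibleSpace ⟨0, by simp⟩
    let Γ := PathConnectedSpace.somePath (stripPoint n (1 / 2)) (stripPoint n (1 / 2 + z * m))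
    obtain ⟨γ, hΓ⟩ := exists_cylinder_loop_of_lift z Γ
    exact ⟨_, (zpowers_cylinder_loop_eq_top_iff γ z Γ hΓ).2 hz,
      (mapOfEq_cylinderToKlein_eq_iff p z γ Γ hΓ).2 h⟩

end Cylindrical

/-! ### Parity and mod 4 obstructions. -/

section Obstruction

variable {m n : ℕ}

instance (m n : ℕ) : Fintype (Square m n) :=
  Fintype.subtype (Finset.Ico (0 : ℤ) m ×ˢ Finset.Ico (0 : ℤ) n) (by simp)

theorem card_square (m n : ℕ) : Fintype.card (Square m n) = m * n := by
  rw [Fintype.card_of_subtype (Finset.Ico (0 : ℤ) m ×ˢ Finset.Ico (0 : ℤ) n) (by simp)]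
  simp

/-- The knight moves, written without absolute values. -/
def IsMove (c : ℤ × ℤ) : Prop :=
  ((c.1 = 1 ∨ c.1 = -1) ∧ (c.2 = 2 ∨ c.2 = -2)) ∨ ((c.1 = 2 ∨ c.1 = -2) ∧ (c.2 = 1 ∨ c.2 = -1))

theorem isMove_iff {c : ℤ × ℤ} :
    IsMove c ↔ (|c.1| = 1 ∧ |c.2| = 2) ∨ (|c.1| = 2 ∧ |c.2| = 1) := by
  simp only [IsMove, abs_eq (zero_le_one' ℤ), abs_eq (zero_le_two : (0 : ℤ) ≤ 2)]

variable [NeZero m] [NeZero n]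

theorem Walk.IsTour.length_squares {u : Square m n} {p : Walk m n u u} (h : p.IsTour) :
    p.squares.length = m * n := by
  classical
  rw [← card_square, ← List.toFinset_card_of_nodup h.1, Finset.card_eq_iff_eq_univ]
  ext v
  simpa using h.2.1 v

theorem Walk.parity_liftEnd {u w : Square m n} (p : Walk m n u w) (v : ℤ × ℤ) :
    ((p.liftEnd v).1 + (p.liftEnd v).2) % 2 = (v.1 + v.2 + p.squares.length) % 2 := by
  induction p generalizing v with
  | nil u => simp [Walk.liftEnd, Walk.squares]
  | cons u c p ih =>
    rw [Walk.liftEnd, Walk.squares, ih, List.length_cons, Prod.fst_add, Prod.snd_add]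
    have := isMove_iff.2 (liftMove_isMove (n := n) v c.2)
    unfold IsMove at this
    push_cast
    omega

theorem not_isCylindrical_of_odd_of_even (hm : Odd m) (hn : Even n)
    (p : Walk m n (origin m n) (origin m n)) (hp : p.IsTour) : ¬ p.IsCylindrical := by
  rw [Walk.isCylindrical_iff]
  intro h
  have h1 := p.parity_liftEnd (0, 0)
  have h2 : Even (m * n) := hn.mul_left m
  rw [hp.length_squares] at h1
  obtain ⟨a, ha⟩ := hm
  obtain ⟨b, hb⟩ := h2
  rcases h with h | h <;> rw [h] at h1 <;> simp only [hb] at h1 <;> push_cast at h1 <;> omega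

theorem Walk.start_mem {u w : Square m n} (p : Walk m n u w) : u ∈ p.squares ++ [w] := by
  cases p <;> simp [Walk.squares]

theorem Walk.start_mem_squares {u w : Square m n} (p : Walk m n u w) (h : p.squares ≠ []) :
    u ∈ p.squares := by
  cases p <;> simp_all [Walk.squares]

/-- Such a move crosses the seam an odd number of times, and the reflection `a ↦ -1 - a` cancels the
horizontal shift ±1 mod 2. -/
theorem step_two_two_eq_self (u : Square 2 2) {c : Move} (h : |c.1.2| = 2) : step u c = u := by
  obtain ⟨⟨a, b⟩, ha, hb⟩ := u
  obtain ⟨⟨c, d⟩, hc⟩ := c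
  have h1 := isMove_iff.2 hc
  unfold IsMove at h1
  have h2 : d = 2 ∨ d = -2 := (abs_eq (by norm_num)).1 h
  apply Subtype.ext
  simp only [step, reduce, Prod.mk_add_mk, Nat.cast_ofNat, Int.even_iff] at *
  ext
  · dsimp only; split_ifs <;> omega
  · dsimp only; omega

/-- Without repeated squares there are no loops, so every move shifts horizontally by ±2, which is 2
mod 4. -/
theorem Walk.liftEnd_two_two {u w : Square 2 2} (p : Walk 2 2 u w)
    (hp : (p.squares ++ [w]).Nodup) (v : ℤ × ℤ) :
    ((p.liftEnd v).1) % 4 = (v.1 + 2 * p.squares.length) % 4 := by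
  induction p generalizing v with
  | nil u => simp [Walk.liftEnd, Walk.squares]
  | cons u c p ih =>
    rw [Walk.squares, List.cons_append, List.nodup_cons] at hp
    rw [Walk.liftEnd, Walk.squares, ih hp.2, List.length_cons, Prod.fst_add]
    have h1 := isMove_iff.2 (liftMove_isMove (n := 2) v c.2)
    have h2 : |c.1.2| ≠ 2 := fun h => hp.1
      ((congrArg (· ∈ p.squares ++ [_]) (step_two_two_eq_self u h)).mp p.start_mem)
    have h3 : (liftMove 2 v c.1).2 = c.1.2 := rfl
    have h4 : c.1.2 ≠ 2 ∧ c.1.2 ≠ -2 := by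
      constructor <;> intro h <;> simp [h] at h2
    unfold IsMove at h1
    push_cast
    omega

theorem not_isCylindrical_two_two (p : Walk 2 2 (origin 2 2) (origin 2 2)) (hp : p.IsTour) :
    ¬ p.IsCylindrical := by
  rw [Walk.isCylindrical_iff]
  intro h
  have hl := hp.length_squares
  have h0 := hp.1
  cases p with
  | nil u => simp [Walk.squares] at hl
  | cons u c p =>
    rw [Walk.squares] at hl h0
    -- The closed walk itself repeats the origin, so its first move is split off and the remaining
    -- open walk is used.
    have hnd : (p.squares ++ [origin 2 2]).Nodup :=
      (List.perm_append_singleton _ _).nodup_iff.2 h0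
    have hc : |c.1.2| ≠ 2 := fun hc => (List.nodup_cons.1 h0).1
      ((congrArg (· ∈ p.squares) (step_two_two_eq_self _ hc)).mp
        (p.start_mem_squares (by rintro h; simp [h] at hl)))
    have h1 := p.liftEnd_two_two hnd ((0, 0) + liftMove 2 (0, 0) c.1)
    have h2 := isMove_iff.2 (liftMove_isMove (n := 2) (0, 0) c.2)
    unfold IsMove at h2
    have h3 : (liftMove 2 (0, 0) c.1).2 = c.1.2 := rfl
    have h4 : c.1.2 ≠ 2 ∧ c.1.2 ≠ -2 := by
      constructor <;> intro h <;> simp [h] at hc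
    rw [Walk.liftEnd] at h
    rw [List.length_cons] at hl
    rw [Prod.fst_add] at h1
    rcases h with h | h <;> rw [h] at h1 <;> push_cast at h1 <;> omega

end Obstruction

/-! ### From lattice paths to tours. -/

section Construction

variable {m n : ℕ}

/-- The first coordinate of a unit square of the plane, reflected if it lies on a sheet of odd
height. -/
def fold (n : ℕ) (v : ℤ × ℤ) : ℤ := if v.2 / (n : ℤ) % 2 = 0 then v.1 else -1 - v.1

/-- The lattice path `P` in the plane projects to a tour of the `m × n` board and moves by `s * m`
horizontally. -/
structure IsTourPath (m n : ℕ) (P : ℕ → ℤ × ℤ) (s : ℤ) : Prop where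
  zero : P 0 = (0, 0)
  isMove : ∀ i < m * n, IsMove (P (i + 1) - P i)
  last : P (m * n) = (s * m, 0)
  sign : s = 1 ∨ s = -1
  injective : ∀ i < m * n, ∀ j < m * n, fold n (P i) % m = fold n (P j) % m →
    (P i).2 % (n : ℤ) = (P j).2 % n → i = j

theorem fold_add_fst (v : ℤ × ℤ) (x : ℤ) :
    fold n (v + (x, 0)) = fold n v + if v.2 / (n : ℤ) % 2 = 0 then x else -x := by
  simp only [fold, Prod.fst_add, Prod.snd_add, add_zero]
  split_ifs <;> ring

/-- Translation by multiples of `m` preserves sheets. Residues mod `m` determine the position within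
a copy, and the residue mod `k * m` then determines which of the `k` copies it is. -/
theorem IsTourPath.iterate {P : ℕ → ℤ × ℤ} {s : ℤ} (h : IsTourPath m n P s) (hm : 0 < m)
    (hn : 0 < n) {k : ℕ} :
    IsTourPath (k * m) n
      (fun i => P (i % (m * n)) + (((i / (m * n) : ℕ) : ℤ) * (s * m), 0)) s := by
  have hN : 0 < m * n := Nat.mul_pos hm hn
  refine ⟨?_, fun i _ => ?_, ?_, h.sign, fun i hi j hj h1 h2 => ?_⟩
  · simp [h.zero]
  · have hlt := Nat.mod_lt i hN
    have hdm := Nat.div_add_mod i (m * n)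
    rcases Nat.lt_or_ge (i % (m * n) + 1) (m * n) with h' | h'
    · have e1 : (i + 1) % (m * n) = i % (m * n) + 1 := by
        rw [← Nat.mod_eq_of_lt h', Nat.mod_add_mod]
      have e2 : (i + 1) / (m * n) = i / (m * n) := by
        rw [Nat.div_eq_iff hN]
        rw [mul_comm] at hdm
        constructor <;> omega
      have := h.isMove _ hlt
      rw [e1, e2, add_sub_add_right_eq_sub]
      exact this
    · have e0 : i % (m * n) + 1 = m * n := by omega
      have e : i + 1 = m * n * (i / (m * n) + 1) := by rw [mul_add]; omega
      have e1 : (i + 1) % (m * n) = 0 := by rw [e, Nat.mul_mod_right]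
      have e2 : (i + 1) / (m * n) = i / (m * n) + 1 := by rw [e, Nat.mul_div_cancel_left _ hN]
      have := h.isMove _ hlt
      rw [e0, h.last] at this
      rw [e1, e2, h.zero]
      convert this using 1
      ext <;> simp
      ring
  · have e : k * m * n = m * n * k := by ring
    rw [e, Nat.mul_mod_right, Nat.mul_div_cancel_left _ hN, h.zero]
    ext <;> simp
    ring
  · simp only [Prod.snd_add, add_zero] at h2
    have h3 := congrArg (· % (m : ℤ)) h1
    rw [Int.emod_emod_of_dvd _ (by exact_mod_cast Dvd.intro_left k rfl),
      Int.emod_emod_of_dvd _ (by exact_mod_cast Dvd.intro_left k rfl)] at h3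
    have hdvd : ∀ (v : ℤ × ℤ) (q : ℤ), fold n (v + (q * (s * m), 0)) % m = fold n v % m := by
      intro v q
      rw [fold_add_fst]
      split_ifs
      · rw [← mul_assoc, Int.add_mul_emod_self_right]
      · rw [← mul_assoc, ← neg_mul, Int.add_mul_emod_self_right]
    rw [hdvd, hdvd] at h3
    have hij := h.injective _ (Nat.mod_lt i hN) _ (Nat.mod_lt j hN) h3 h2
    rw [hij, fold_add_fst, fold_add_fst] at h1
    have hq : ∀ l < k * m * n, ((l / (m * n) : ℕ) : ℤ) < k := by
      intro l hl
      have : l / (m * n) < k := Nat.div_lt_of_lt_mul (by rwa [mul_comm, ← mul_assoc])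
      exact_mod_cast this
    have hqi := hq i hi
    have hqj := hq j hj
    have hm' : (m : ℤ) ≠ 0 := by exact_mod_cast hm.ne'
    have key : (((k * m : ℕ) : ℤ)) ∣
        (((j / (m * n) : ℕ) : ℤ) - ((i / (m * n) : ℕ) : ℤ)) * m := by
      have h4 := Int.ModEq.dvd h1
      obtain ⟨y, hy⟩ := h4
      -- Both the direction `s` and a reflecting sheet can reverse the translation; neither affects
      -- divisibility.
      rcases h.sign with rfl | rfl <;> split_ifs at hy
      · exact ⟨y, by linear_combination hy⟩
      · exact ⟨-y, by linear_combination -hy⟩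
      · exact ⟨-y, by linear_combination -hy⟩
      · exact ⟨y, by linear_combination hy⟩
    push_cast at key
    have h5 := Int.dvd_of_mul_dvd_mul_right hm' key
    have h6 : ((j / (m * n) : ℕ) : ℤ) - ((i / (m * n) : ℕ) : ℤ) = 0 :=
      Int.eq_zero_of_abs_lt_dvd h5 (abs_sub_lt_of_nonneg_of_lt (Int.natCast_nonneg _) hqj
        (Int.natCast_nonneg _) hqi)
    have h7 : i / (m * n) = j / (m * n) := by exact_mod_cast (sub_eq_zero.1 h6).symm
    rw [← Nat.div_add_mod i (m * n), ← Nat.div_add_mod j (m * n), h7, hij]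

variable [NeZero m] [NeZero n]

theorem reduce_eq_iff {v w : ℤ × ℤ} : reduce m n v = reduce m n w ↔
    fold n v % m = fold n w % m ∧ v.2 % (n : ℤ) = w.2 % n := by
  simp only [reduce, fold, Subtype.mk.injEq, Prod.mk.injEq, Int.even_iff]

theorem exists_walk (k : ℕ) (P : ℕ → ℤ × ℤ) (hP : ∀ i < k, IsMove (P (i + 1) - P i))
    {u w : Square m n} (hu : reduce m n (P 0) = u) (hw : reduce m n (P k) = w) :
    ∃ (p : Walk m n u w) (c : ℕ → Move),
      p.squares = (List.range k).map (fun i => reduce m n (P i)) ∧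
      p.edges = (List.range k).map (fun i => edge (reduce m n (P i)) (c i)) ∧
      (∀ i < k, (c i).1 = liftMove n (P i) (P (i + 1) - P i)) ∧ p.liftEnd (P 0) = P k := by
  induction k generalizing P u with
  | zero =>
    subst hw hu
    exact ⟨.nil _, fun _ => ⟨(1, 2), by simp⟩, by simp [Walk.squares], by simp [Walk.edges],
      by simp, rfl⟩
  | succ k ih =>
    subst hu
    let c : Move := ⟨liftMove n (P 0) (P 1 - P 0),
      liftMove_isMove _ (isMove_iff.1 (hP 0 k.succ_pos))⟩
    have hc : P 0 + liftMove n (P 0) c.1 = P 1 := by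
      rw [liftMove_liftMove, add_sub_cancel]
    obtain ⟨p, d, h1, h2, h3, h4⟩ := ih (fun i => P (i + 1))
      (fun i hi => hP (i + 1) (Nat.succ_lt_succ hi)) (u := step (reduce m n (P 0)) c)
      (by rw [step_reduce, hc]) hw
    refine ⟨.cons _ c p, fun i => Nat.casesOn i c d, ?_, ?_, ?_, ?_⟩
    · rw [Walk.squares, h1, List.range_succ_eq_map, List.map_cons, List.map_map]; rfl
    · rw [Walk.edges, h2, List.range_succ_eq_map, List.map_cons, List.map_map]; rfl
    · rintro (_ | i) hi
      · rfl
      · exact h3 i (Nat.lt_of_succ_lt_succ hi)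
    · rw [Walk.liftEnd, hc]; exact h4

/-- Since squares are not repeated, an edge could only recur traversed backwards. Its two positions
would then be cyclic successors of each other, which is impossible for more than two squares. -/
theorem IsTourPath.exists_tour {P : ℕ → ℤ × ℤ} {s : ℤ} (h : IsTourPath m n P s)
    (h2 : 2 < m * n) :
    ∃ p : Walk m n (origin m n) (origin m n), p.IsTour ∧ p.IsCylindrical := by
  have h0 : reduce m n (P 0) = origin m n := by
    rw [h.zero]; apply Subtype.ext; simp [reduce, origin]
  have hN : reduce m n (P (m * n)) = origin m n := by
    rw [h.last]; apply Subtype.ext; simp [reduce, origin]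
  have hinj : ∀ i < m * n, ∀ j < m * n, reduce m n (P i) = reduce m n (P j) → i = j :=
    fun i hi j hj hij => h.injective i hi j hj (reduce_eq_iff.1 hij).1 (reduce_eq_iff.1 hij).2
  obtain ⟨p, c, hs, he, hc, hl⟩ := exists_walk (m * n) P h.isMove h0 hN
  have hstep : ∀ i < m * n, step (reduce m n (P i)) (c i) = reduce m n (P (i + 1)) := by
    intro i hi
    rw [step_reduce, hc i hi, liftMove_liftMove, add_sub_cancel]
  have hnd : p.squares.Nodup := by
    rw [hs]
    refine List.Nodup.map_on ?_ List.nodup_range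
    intro i hi j hj
    exact hinj i (List.mem_range.1 hi) j (List.mem_range.1 hj)
  refine ⟨p, ⟨hnd, ?_, ?_⟩, p.isCylindrical_iff.2 ?_⟩
  · classical
    have h3 : p.squares.toFinset = Finset.univ := by
      rw [← Finset.card_eq_iff_eq_univ, List.toFinset_card_of_nodup hnd, card_square, hs]
      simp
    intro v
    rw [← List.mem_toFinset, h3]
    exact Finset.mem_univ v
  · rw [he]
    refine List.Nodup.map_on ?_ List.nodup_range
    intro i hi j hj hij
    rw [List.mem_range] at hi hj
    rcases Sym2.eq_iff.1 hij with ⟨h3, -⟩ | ⟨h3, h4⟩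
    · exact hinj i hi j hj (Prod.mk.inj h3).1
    · have h5 := (Prod.mk.inj h3).1
      have h6 := (Prod.mk.inj h4).1
      rw [hstep j hj] at h5
      rw [hstep i hi] at h6
      have next : ∀ i < m * n, ∀ j < m * n, reduce m n (P i) = reduce m n (P (j + 1)) →
          i = j + 1 ∨ (i = 0 ∧ j + 1 = m * n) := by
        intro i hi j hj h5
        rcases Nat.lt_or_ge (j + 1) (m * n) with hj' | hj'
        · exact Or.inl (hinj _ hi _ hj' h5)
        · have hj'' : j + 1 = m * n := by omega
          rw [hj'', hN, ← h0] at h5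
          exact Or.inr ⟨hinj _ hi _ (by omega) h5, hj''⟩
      have h7 := next i hi j hj h5
      have h8 := next j hj i hi h6.symm
      omega
  · rw [h.zero, h.last] at hl
    rw [hl]
    rcases h.sign with rfl | rfl
    · left; simp
    · right; simp

/-- The board of width two and height one has a tour with two parallel edges. -/
theorem exists_tour_two_one :
    ∃ p : Walk 2 1 (origin 2 1) (origin 2 1), p.IsTour ∧ p.IsCylindrical := by
  let P : ℕ → ℤ × ℤ := fun i => if i = 0 then (0, 0) else if i = 1 then (1, 2) else (2, 0)
  have hP : ∀ i < 2, IsMove (P (i + 1) - P i) := by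
    intro i hi
    interval_cases i <;> simp [P, IsMove]
  obtain ⟨p, c, hs, he, hc, hl⟩ := exists_walk 2 P hP (u := origin 2 1) (w := origin 2 1)
    (by decide) (by decide)
  refine ⟨p, ⟨?_, ?_, ?_⟩, p.isCylindrical_iff.2 (Or.inl hl)⟩
  · rw [hs]; decide
  · rw [hs]
    rintro ⟨⟨a, b⟩, ⟨ha, ha'⟩, hb, hb'⟩
    simp only [Nat.cast_ofNat, Nat.cast_one] at ha ha' hb hb'
    obtain rfl : b = 0 := by omega
    obtain rfl | rfl : a = 0 ∨ a = 1 := by omega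
    · exact List.mem_map.2 ⟨0, by decide, Subtype.ext (by change _ = ((0 : ℤ), (0 : ℤ)); decide)⟩
    · exact List.mem_map.2 ⟨1, by decide, Subtype.ext (by change _ = ((1 : ℤ), (0 : ℤ)); decide)⟩
  -- Both edges join the same two squares, so they must be told apart by their moves.
  · have h0 : c 0 = ⟨(1, 2), by simp⟩ := Subtype.ext (hc 0 (by norm_num))
    have h1 : c 1 = ⟨(1, -2), by simp⟩ := Subtype.ext (hc 1 (by norm_num))
    rw [he]
    simp only [List.range_succ_eq_map, List.range_zero, List.map_cons, List.map_nil, h0, h1,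
      Nat.succ_eq_add_one, zero_add]
    decide

end Construction

/-! ### Explicit base paths. -/

section Paths

theorem fold_of_mem_Ico {n : ℕ} {v : ℤ × ℤ} (h0 : 0 ≤ v.2) (hn : v.2 < n) : fold n v = v.1 := by
  rw [fold, Int.ediv_eq_zero_of_lt h0 hn, Int.zero_emod, if_pos rfl]

theorem isTourPath_two_one :
    IsTourPath 2 1 (fun i => [(0, 0), (1, 2), (2, 0)].getD i (0, 0)) 1 := by
  refine ⟨rfl, ?_, rfl, Or.inl rfl, ?_⟩
  · unfold IsMove; decide
  · unfold fold; decide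

theorem isTourPath_four_two :
    IsTourPath 4 2 (fun i => [(0, 0), (-2, -1), (-4, -2), (-6, -3), (-5, -5), (-3, -4), (-5, -3),
      (-3, -2), (-4, 0)].getD i (0, 0)) (-1) := by
  refine ⟨rfl, ?_, rfl, Or.inr rfl, ?_⟩
  · unfold IsMove; decide
  · unfold fold; decide

theorem isTourPath_two_four :
    IsTourPath 2 4 (fun i => [(0, 0), (1, 2), (2, 4), (3, 6), (1, 7), (0, 5), (1, 3), (0, 1),
      (2, 0)].getD i (0, 0)) 1 := by
  refine ⟨rfl, ?_, rfl, Or.inl rfl, ?_⟩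
  · unfold IsMove; decide
  · unfold fold; decide

theorem exists_isTourPath_odd_one {m : ℕ} (hm : Odd m) (h3 : 3 ≤ m) :
    ∃ P, IsTourPath m 1 P (-1) := by
  obtain ⟨k, hk⟩ := hm
  let P : ℕ → ℤ × ℤ := fun i =>
    if i = 0 then (0, 0)
    else if i + 2 ≤ m then (-1 - i, if i % 2 = 1 then -1 else 1)
    else if i + 1 = m then (-1 - m, -2) else (-m, 0)
  have hP : ∀ i ≤ m, (i = 0 ∧ (P i).1 = 0 ∧ (P i).2 = 0) ∨
      (1 ≤ i ∧ i + 2 ≤ m ∧ i % 2 = 1 ∧ (P i).1 = -1 - i ∧ (P i).2 = -1) ∨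
      (1 ≤ i ∧ i + 2 ≤ m ∧ i % 2 = 0 ∧ (P i).1 = -1 - i ∧ (P i).2 = 1) ∨
      (i + 1 = m ∧ (P i).1 = -1 - m ∧ (P i).2 = -2) ∨
      (i = m ∧ (P i).1 = -m ∧ (P i).2 = 0) := by
    intro i hi
    simp only [P]
    split_ifs <;> dsimp only <;> omega
  -- Step `i` visits column `i`: odd rows turn `-1 - i` into `i`, and the one exceptional position
  -- `i = m - 1` lies on an even row.
  have hfold : ∀ i < m, fold 1 (P i) % m = i := by
    intro i hi
    have h1 : fold 1 (P i) = i ∨ fold 1 (P i) = i - m * 2 := by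
      have h2 := hP i hi.le
      simp only [fold, Nat.cast_one, Int.ediv_one]
      split_ifs <;> omega
    rcases h1 with h1 | h1 <;> rw [h1]
    · exact Int.emod_eq_of_lt (by omega) (by omega)
    · rw [Int.sub_mul_emod_self_left, Int.emod_eq_of_lt (by omega) (by omega)]
  refine ⟨P, by simp [P], fun i hi => ?_, ?_, Or.inr rfl, fun i hi j hj h1 h2 => ?_⟩
  · rw [mul_one] at hi
    have h1 := hP i hi.le
    have h2 := hP (i + 1) hi
    simp only [IsMove, Prod.fst_sub, Prod.snd_sub]
    omega
  · have h1 := hP m le_rfl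
    rw [mul_one]
    ext <;> dsimp only <;> omega
  · rw [mul_one] at hi hj
    rw [hfold i hi, hfold j hj] at h1
    exact_mod_cast h1

theorem exists_isTourPath_one_odd {n : ℕ} (hn : Odd n) (h3 : 3 ≤ n) :
    ∃ P, IsTourPath 1 n P 1 := by
  obtain ⟨h, rfl⟩ := hn
  -- Up through the even rows, then down through the odd rows; with a single column, rows alone
  -- distinguish squares.
  let P : ℕ → ℤ × ℤ := fun i =>
    if i ≤ h then (i, 2 * i)
    else if i ≤ 2 * h then (2 * h - 1 - i, 2 * (2 * h + 1 - i) - 1) else (1, 0)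
  have hrow : ∀ i < 2 * h + 1, (P i).2 % ((2 * h + 1 : ℕ) : ℤ) = (P i).2 := by
    intro i hi
    refine Int.emod_eq_of_lt ?_ ?_ <;> simp only [P] <;> split_ifs <;> dsimp only <;> omega
  refine ⟨P, by simp [P], fun i hi => ?_, ?_, Or.inl rfl, fun i hi j hj h1 h2 => ?_⟩
  · rw [one_mul] at hi
    simp only [P]
    split_ifs <;> simp only [IsMove, Prod.mk_sub_mk] <;> omega
  · simp only [P]
    split_ifs <;> simp_all
    omega
  · rw [one_mul] at hi hj
    rw [hrow i hi, hrow j hj] at h2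
    simp only [P] at h2
    split_ifs at h2 <;> dsimp only at h2 <;> omega

theorem exists_isTourPath_two_even {n : ℕ} (hn : Even n) (h6 : 6 ≤ n) :
    ∃ P, IsTourPath 2 n P (-1) := by
  obtain ⟨h, rfl⟩ := hn
  -- Two sweeps, each up the even rows and down the odd ones, inside a single sheet. The first three
  -- squares supply what the sweeps omit: row 1 of the first, rows 0 and 2 of the second.
  let P : ℕ → ℤ × ℤ := fun i =>
    if i = 0 then (0, 0) else if i = 1 then (-1, 2) else if i = 2 then (1, 1)
    else if i ≤ h + 2 then (i - 4, 2 * i - 6)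
    else if i ≤ 2 * h + 1 then (2 * h + 3 - i, 4 * h + 5 - 2 * i)
    else if i + 1 ≤ 3 * h then (i - 2 * h - 2, 2 * i - 4 * h)
    else if i + 1 ≤ 4 * h then (4 * h - 1 - i, 8 * h - 1 - 2 * i)
    else (-2, 0)
  have hP : ∀ i ≤ 4 * h, (i = 0 ∧ (P i).1 = 0 ∧ (P i).2 = 0) ∨
      (i = 1 ∧ (P i).1 = -1 ∧ (P i).2 = 2) ∨
      (i = 2 ∧ (P i).1 = 1 ∧ (P i).2 = 1) ∨
      (3 ≤ i ∧ i ≤ h + 2 ∧ (P i).1 = i - 4 ∧ (P i).2 = 2 * i - 6) ∨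
      (h + 3 ≤ i ∧ i ≤ 2 * h + 1 ∧ (P i).1 = 2 * h + 3 - i ∧ (P i).2 = 4 * h + 5 - 2 * i) ∨
      (2 * h + 2 ≤ i ∧ i + 1 ≤ 3 * h ∧ (P i).1 = i - 2 * h - 2 ∧ (P i).2 = 2 * i - 4 * h) ∨
      (3 * h ≤ i ∧ i + 1 ≤ 4 * h ∧ (P i).1 = 4 * h - 1 - i ∧ (P i).2 = 8 * h - 1 - 2 * i) ∨
      (i = 4 * h ∧ (P i).1 = -2 ∧ (P i).2 = 0) := by
    intro i hi
    simp only [P]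
    split_ifs with h0 h1 h2
    · exact .inl ⟨h0, rfl, rfl⟩
    · exact .inr (.inl ⟨h1, rfl, rfl⟩)
    · exact .inr (.inr (.inl ⟨h2, rfl, rfl⟩))
    · exact .inr (.inr (.inr (.inl ⟨by omega, by omega, rfl, rfl⟩)))
    · exact .inr (.inr (.inr (.inr (.inl ⟨by omega, by omega, rfl, rfl⟩))))
    · exact .inr (.inr (.inr (.inr (.inr (.inl ⟨by omega, by omega, rfl, rfl⟩)))))
    · exact .inr (.inr (.inr (.inr (.inr (.inr (.inl ⟨by omega, by omega, rfl, rfl⟩))))))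
    · exact .inr (.inr (.inr (.inr (.inr (.inr (.inr ⟨by omega, rfl, rfl⟩))))))
  have hrow : ∀ i < 4 * h, 0 ≤ (P i).2 ∧ (P i).2 < ((h + h : ℕ) : ℤ) := by
    intro i hi
    have h1 := hP i hi.le
    omega
  have hP0 : P 0 = (0, 0) := rfl
  have e : 2 * (h + h) = 4 * h := by ring
  clear_value P
  refine ⟨P, hP0, fun i hi => ?_, ?_, Or.inr rfl, fun i hi j hj h1 h2 => ?_⟩
  · rw [e] at hi
    have h2 := hP (i + 1) hi
    simp only [IsMove, Prod.fst_sub, Prod.snd_sub]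
    rcases hP i hi.le with h1 | h1 | h1 | h1 | h1 | h1 | h1 | h1 <;> omega
  · have h1 := hP (4 * h) le_rfl
    rw [e]
    ext <;> dsimp only <;> omega
  · rw [e] at hi hj
    obtain ⟨hi0, hi1⟩ := hrow i hi
    obtain ⟨hj0, hj1⟩ := hrow j hj
    rw [Int.emod_eq_of_lt hi0 hi1, Int.emod_eq_of_lt hj0 hj1] at h2
    rw [fold_of_mem_Ico hi0 hi1, fold_of_mem_Ico hj0 hj1, Nat.cast_ofNat] at h1
    clear hi0 hi1 hj0 hj1 hrow
    rcases hP i hi.le with h3 | h3 | h3 | h3 | h3 | h3 | h3 | h3 <;>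
      rcases hP j hj.le with h4 | h4 | h4 | h4 | h4 | h4 | h4 | h4 <;> omega

end Paths

/-! ### Height two and width congruent to 2 mod 4. -/

section WidthTwoModFour

/-- A tour of the board of width `4 * k + 6` and height two: a block of eight moves that advances
by four columns is repeated `k` times between an initial and a final piece. -/
def pathHeightTwo (k i : ℕ) : ℤ × ℤ :=
  if i < 7 then
    [(0, 0), (2, -1), (0, -2), (-2, -1), (-1, 1), (1, 0), (-1, -1)].getD i (0, 0)
  else if i < 7 + 8 * k then
    [(-3, 0), (-5, -1), (-4, -3), (-6, -2), (-4, -1), (-2, 0), (-3, 2), (-5, 1)].getD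
      ((i - 7) % 8) (0, 0) - (4 * (((i - 7) / 8 : ℕ) : ℤ), 0)
  else
    [(-3, 0), (-5, -1), (-3, -2), (-2, 0), (-4, 1), (-6, 0)].getD (i - (7 + 8 * k)) (0, 0) -
      (4 * (k : ℤ), 0)

theorem pathHeightTwo_initial {k i : ℕ} (hi : i < 7) : pathHeightTwo k i =
    [(0, 0), (2, -1), (0, -2), (-2, -1), (-1, 1), (1, 0), (-1, -1)].getD i (0, 0) :=
  if_pos hi

theorem pathHeightTwo_block {k q t : ℕ} (hq : q < k) (ht : t < 8) :
    pathHeightTwo k (7 + 8 * q + t) =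
    [(-3, 0), (-5, -1), (-4, -3), (-6, -2), (-4, -1), (-2, 0), (-3, 2), (-5, 1)].getD
      t (0, 0) - (4 * (q : ℤ), 0) := by
  have e1 : (7 + 8 * q + t - 7) % 8 = t := by omega
  have e2 : (7 + 8 * q + t - 7) / 8 = q := by omega
  rw [pathHeightTwo, if_neg (by omega), if_pos (by omega), e1, e2]

theorem pathHeightTwo_final {k t : ℕ} :
    pathHeightTwo k (7 + 8 * k + t) =
    [(-3, 0), (-5, -1), (-3, -2), (-2, 0), (-4, 1), (-6, 0)].getD t (0, 0) -
      (4 * (k : ℤ), 0) := by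
  rw [pathHeightTwo, if_neg (by omega), if_neg (by omega), Nat.add_sub_cancel_left]

/-- Covers the start of the final piece as well (`q = k`), so the joins between successive pieces
are handled uniformly. -/
theorem pathHeightTwo_block_start {k q : ℕ} (hq : q ≤ k) :
    pathHeightTwo k (7 + 8 * q) = (-3 - 4 * (q : ℤ), 0) := by
  rcases hq.lt_or_eq with h | rfl
  · exact (pathHeightTwo_block h (t := 0) (by norm_num)).trans (by simp)
  · exact (pathHeightTwo_final (t := 0)).trans (by simp)

theorem index_cases {k i : ℕ} (hi : i < 12 + 8 * k) : i < 7 ∨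
    (∃ q t, q < k ∧ t < 8 ∧ i = 7 + 8 * q + t) ∨ ∃ t < 5, i = 7 + 8 * k + t := by
  rcases Nat.lt_or_ge i 7 with h | h
  · exact Or.inl h
  · rcases Nat.lt_or_ge i (7 + 8 * k) with h' | h'
    · exact Or.inr (Or.inl ⟨(i - 7) / 8, (i - 7) % 8, by omega, by omega, by omega⟩)
    · exact Or.inr (Or.inr ⟨i - (7 + 8 * k), by omega, by omega⟩)

theorem isMove_pathHeightTwo {k i : ℕ} (hi : i < 12 + 8 * k) :
    IsMove (pathHeightTwo k (i + 1) - pathHeightTwo k i) := by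
  rcases index_cases hi with h | ⟨q, t, hq, ht, rfl⟩ | ⟨t, ht, rfl⟩
  · rcases Nat.lt_or_ge (i + 1) 7 with h' | h'
    · rw [pathHeightTwo_initial h, pathHeightTwo_initial h']
      have h'' : i < 6 := by omega
      clear h h' hi
      interval_cases i <;> simp [IsMove]
    · obtain rfl : i = 6 := by omega
      have := pathHeightTwo_block_start (Nat.zero_le k)
      rw [pathHeightTwo_initial h]
      simp only [mul_zero, add_zero] at this
      rw [this]
      simp [IsMove]
  · rw [pathHeightTwo_block hq ht]
    rcases Nat.lt_or_ge (t + 1) 8 with h' | h'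
    · rw [add_assoc _ t 1, pathHeightTwo_block hq h', sub_sub_sub_cancel_right]
      have h'' : t < 7 := by omega
      clear ht h' hi
      interval_cases t <;> simp [IsMove]
    · obtain rfl : t = 7 := by omega
      rw [show 7 + 8 * q + 7 + 1 = 7 + 8 * (q + 1) by ring, pathHeightTwo_block_start hq]
      simp only [IsMove, List.getD_cons_succ, List.getD_cons_zero, Prod.mk_sub_mk]
      push_cast
      exact Or.inr ⟨Or.inr (by ring), Or.inr (by norm_num)⟩
  · rw [pathHeightTwo_final, add_assoc _ t 1, pathHeightTwo_final, sub_sub_sub_cancel_right]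
    interval_cases t <;> simp [IsMove]

/-- The position in `pathHeightTwo k` of the square in column `r` and row `b`. -/
def indexHeightTwo (k r b : ℤ) : ℤ :=
  if b = 0 then
    if r = 0 then 0 else if r = 1 then 5 else if r = 3 then 7 + 8 * k else if r = 4 then 10 + 8 * k
    else if r = 4 * k + 2 then 9 + 8 * k else if r = 4 * k + 5 then 2
    else if r % 4 = 0 then 12 + 8 * ((4 * k + 4 - r) / 4)
    else if r % 4 = 1 then 10 + 8 * ((r - 5) / 4)
    else if r % 4 = 2 then 13 + 8 * ((r - 2) / 4)
    else 7 + 8 * ((4 * k + 3 - r) / 4)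
  else
    if r = 0 then 6 else if r = 1 then 3 else if r = 2 then 11 + 8 * k
    else if r = 4 * k + 3 then 1 else if r = 4 * k + 4 then 8 + 8 * k else if r = 4 * k + 5 then 4
    else if r % 4 = 0 then 8 + 8 * ((r - 4) / 4)
    else if r % 4 = 1 then 14 + 8 * ((4 * k + 1 - r) / 4)
    else if r % 4 = 2 then 9 + 8 * ((4 * k + 2 - r) / 4)
    else 11 + 8 * ((r - 3) / 4)

/-- The folded coordinate lies within one width of 0, so its residue is itself or itself plus the
width. This replaces the remainder by a nonlinear modulus with two linear cases. -/
theorem indexHeightTwo_reduce {k : ℕ} {x y b i : ℤ} (hb : y % 2 = b)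
    (h : -(4 * (k : ℤ) + 6) ≤ if y / 2 % 2 = 0 then x else -1 - x)
    (h' : (if y / 2 % 2 = 0 then x else -1 - x) < 4 * k + 6)
    (hi : ∀ r : ℤ, 0 ≤ r → r < 4 * k + 6 →
      (r = (if y / 2 % 2 = 0 then x else -1 - x) ∨
        r = (if y / 2 % 2 = 0 then x else -1 - x) + (4 * k + 6)) → indexHeightTwo k r b = i) :
    indexHeightTwo k (fold 2 (x, y) % (4 * k + 6)) (y % 2) = i := by
  have hk : 0 < 4 * (k : ℤ) + 6 := by omega
  have hfold : fold 2 (x, y) = if y / 2 % 2 = 0 then x else -1 - x := rfl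
  rw [← hfold] at h h' hi
  rw [hb]
  refine hi _ (Int.emod_nonneg _ hk.ne') (Int.emod_lt_of_pos _ hk) ?_
  rcases lt_or_ge (fold 2 (x, y)) 0 with h0 | h0
  · right
    rw [← Int.add_emod_right, Int.emod_eq_of_lt (by omega) (by omega)]
  · exact .inl (Int.emod_eq_of_lt h0 h')

theorem indexHeightTwo_initial {k i : ℕ} (hi : i < 7) :
    indexHeightTwo k (fold 2 (pathHeightTwo k i) % (4 * k + 6)) ((pathHeightTwo k i).2 % 2) =
      i := by
  rw [pathHeightTwo_initial hi]
  interval_cases i <;> simp only [List.getD_cons_succ, List.getD_cons_zero]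
  all_goals
    first
      | refine indexHeightTwo_reduce (b := 0) rfl (by norm_num; try omega) (by norm_num; try omega)
          fun r h0 h1 hr => ?_
      | refine indexHeightTwo_reduce (b := 1) rfl (by norm_num; try omega) (by norm_num; try omega)
          fun r h0 h1 hr => ?_
    norm_num only [if_true, if_false] at hr
    norm_num only [indexHeightTwo, if_true, if_false]
    rcases hr with hr | hr <;> omega

theorem indexHeightTwo_block {k q t : ℕ} (hq : q < k) (ht : t < 8) :
    indexHeightTwo k (fold 2 (pathHeightTwo k (7 + 8 * q + t)) % (4 * k + 6))
      ((pathHeightTwo k (7 + 8 * q + t)).2 % 2) = (7 + 8 * q + t : ℕ) := by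
  rw [pathHeightTwo_block hq ht]
  interval_cases t <;> simp only [List.getD_cons_succ, List.getD_cons_zero, Prod.mk_sub_mk]
  all_goals
    first
      | refine indexHeightTwo_reduce (b := 0) rfl (by norm_num; try omega) (by norm_num; try omega)
          fun r h0 h1 hr => ?_
      | refine indexHeightTwo_reduce (b := 1) rfl (by norm_num; try omega) (by norm_num; try omega)
          fun r h0 h1 hr => ?_
    norm_num only [if_true, if_false] at hr
    norm_num only [indexHeightTwo, if_true, if_false]
    rcases hr with hr | hr <;> omega

theorem indexHeightTwo_final {k t : ℕ} (ht : t < 5) :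
    indexHeightTwo k (fold 2 (pathHeightTwo k (7 + 8 * k + t)) % (4 * k + 6))
      ((pathHeightTwo k (7 + 8 * k + t)).2 % 2) = (7 + 8 * k + t : ℕ) := by
  rw [pathHeightTwo_final]
  interval_cases t <;> simp only [List.getD_cons_succ, List.getD_cons_zero, Prod.mk_sub_mk]
  all_goals
    first
      | refine indexHeightTwo_reduce (b := 0) rfl (by norm_num; try omega) (by norm_num; try omega)
          fun r h0 h1 hr => ?_
      | refine indexHeightTwo_reduce (b := 1) rfl (by norm_num; try omega) (by norm_num; try omega)
          fun r h0 h1 hr => ?_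
    norm_num only [if_true, if_false] at hr
    norm_num only [indexHeightTwo, if_true, if_false]
    rcases hr with hr | hr <;> omega

/-- A left inverse to the path on squares, which yields its injectivity. -/
theorem indexHeightTwo_pathHeightTwo {k i : ℕ} (hi : i < 12 + 8 * k) :
    indexHeightTwo k (fold 2 (pathHeightTwo k i) % (4 * k + 6)) ((pathHeightTwo k i).2 % 2) =
      i := by
  rcases index_cases hi with h | ⟨q, t, hq, ht, rfl⟩ | ⟨t, ht, rfl⟩
  · exact indexHeightTwo_initial h
  · exact indexHeightTwo_block hq ht
  · exact indexHeightTwo_final ht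

theorem isTourPath_pathHeightTwo (k : ℕ) : IsTourPath (4 * k + 6) 2 (pathHeightTwo k) (-1) := by
  have e : (4 * k + 6) * 2 = 12 + 8 * k := by ring
  refine ⟨rfl, fun i hi => isMove_pathHeightTwo (e ▸ hi), ?_, Or.inr rfl,
    fun i hi j hj h1 h2 => ?_⟩
  · rw [e, show 12 + 8 * k = 7 + 8 * k + 5 by ring, pathHeightTwo_final]
    ext <;> simp
    ring
  · have hi' := indexHeightTwo_pathHeightTwo (e ▸ hi)
    have hj' := indexHeightTwo_pathHeightTwo (e ▸ hj)
    push_cast at h1 h2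
    rw [h1, h2, hj'] at hi'
    exact_mod_cast hi'.symm

end WidthTwoModFour

end KnightTour

end

/-! ### Assembly of the cases. -/

theorem theorem6p2 (m n : ℕ) [NeZero m] [NeZero n] (h : 1 < max m n) :
    (∃ p : KnightTour.Walk m n (KnightTour.origin m n) (KnightTour.origin m n),
        p.IsTour ∧ p.IsCylindrical) ↔
      ¬ (m = 2 ∧ n = 2) ∧ ¬ (Odd m ∧ Even n) := by
  constructor
  · rintro ⟨p, hp, hc⟩
    refine ⟨?_, fun hmn => KnightTour.not_isCylindrical_of_odd_of_even hmn.1 hmn.2 p hp hc⟩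
    rintro ⟨rfl, rfl⟩
    exact KnightTour.not_isCylindrical_two_two p hp hc
  · rintro ⟨h22, hoe⟩
    have hm := Nat.pos_of_ne_zero (NeZero.ne m)
    have hn := Nat.pos_of_ne_zero (NeZero.ne n)
    rcases Nat.even_or_odd n with hn2 | hn2
    · have hm2 : Even m := Nat.not_odd_iff_even.1 fun hm2 => hoe ⟨hm2, hn2⟩
      obtain ⟨a, ha⟩ := hm2
      obtain ⟨b, hb⟩ := hn2
      have hlt : 2 < m * n :=
        lt_of_lt_of_le (by norm_num) (Nat.mul_le_mul (by omega : 2 ≤ m) (by omega : 2 ≤ n))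
      rcases Nat.lt_or_ge n 3 with h3 | h3
      · obtain rfl : n = 2 := by omega
        rcases Nat.even_or_odd' a with ⟨k, hk | hk⟩
        · obtain rfl : m = k * 4 := by omega
          exact (KnightTour.isTourPath_four_two.iterate (by norm_num) (by norm_num)).exists_tour hlt
        -- Width 2 is excluded by hypothesis, so the smallest width here is 6.
        · obtain ⟨l, rfl⟩ : ∃ l, m = 4 * l + 6 := ⟨k - 1, by omega⟩
          exact (KnightTour.isTourPath_pathHeightTwo l).exists_tour hlt
      · obtain rfl : m = a * 2 := by omega
        rcases Nat.lt_or_ge n 5 with h5 | h5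
        · obtain rfl : n = 4 := by omega
          exact (KnightTour.isTourPath_two_four.iterate (by norm_num) (by norm_num)).exists_tour hlt
        · obtain ⟨P, hP⟩ := KnightTour.exists_isTourPath_two_even ⟨b, hb⟩ (by omega)
          exact (hP.iterate (by norm_num) hn).exists_tour hlt
    · rcases Nat.lt_or_ge n 3 with h3 | h3
      · obtain rfl : n = 1 := by obtain ⟨b, hb⟩ := hn2; omega
        have hm1 : 2 ≤ m := by omega
        rcases Nat.even_or_odd m with ⟨a, ha⟩ | hm2
        · obtain rfl : m = a * 2 := by omega
          -- The 2 × 1 board has only two squares, too few for `IsTourPath.exists_tour`.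
          rcases Nat.lt_or_ge a 2 with ha2 | ha2
          · obtain rfl : a = 1 := by omega
            exact KnightTour.exists_tour_two_one
          · exact (KnightTour.isTourPath_two_one.iterate (by norm_num) hn).exists_tour (by omega)
        · have hm3 : 3 ≤ m := by obtain ⟨a, ha⟩ := hm2; omega
          obtain ⟨P, hP⟩ := KnightTour.exists_isTourPath_odd_one hm2 hm3
          exact hP.exists_tour (by omega)
      · obtain ⟨P, hP⟩ := KnightTour.exists_isTourPath_one_odd hn2 h3
        have hQ := hP.iterate one_pos hn (k := m)
        rw [mul_one] at hQ
        exact hQ.exists_tour (by nlinarith)
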